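/- Let $X$ be a finite set, let $X^*$ be the set of finite words over $X$, seen as a rooted tree whose root is the empty word and in which $u$ is adjacent to $ux$ for $u\in X^*$, $x\in X$, and let $X^{-\omega}$ be the space of left-infinite words $\ldots x_2x_1$ over $X$ with the product topology ($X$ discrete). Let a group $G$ act faithfully on $X^*$ by automorphisms of the rooted tree, and suppose that the action is self-similar: for all $g\in G$, $x\in X$ there are $y\in X$ and $h\in G$ with $g(xw)=y\,h(w)$ for all $w\in X^*$; then $y=g(x)$ and $h=:g|_x$ is unique. Put $g|_\varnothing=g$ and $g|_{xv}=(g|_x)|_v$. Suppose that the action is contracting, that is, there is a finite set $N\subset G$ such that for every $g\in G$ there is $k\in\mathbb N$ with $g|_w\in N$ for all words $w$ of length at least $k$; the smallest such $N$ is the nucleus $\mathcal N$. The Moore diagram of $\mathcal N$ is the directed graph with vertex set (set of states) $\mathcal N$ and, for all $g\in\mathcal N$ and $x\in X$, an edge from $g$ to $g|_x$ with label $(x,g(x))$. A left-infinite path $\ldots e_2e_1$ in it consists of edges $e_n$, $n\ge1$, such that $e_{n+1}$ ends where $e_n$ starts; the path ends at the endpoint of $e_1$. Words $\ldots x_2x_1$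 and $\ldots y_2y_1$ in $X^{-\omega}$ are asymptotically equivalent if there is a sequence $(g_k)_{k\ge1}$ in $G$ taking only finitely many values with $g_k(x_k\ldots x_1)=y_k\ldots y_1$ for all $k\ge1$. The limit space $\mathcal J_G$ is the quotient space of $X^{-\omega}$ by this equivalence relation, and $p:X^{-\omega}\to\mathcal J_G$ is the quotient map. A self-similar structure on a compact metrizable space $K$ consists of continuous injections $F_i:K\to K$ $(i\in X)$ for which there is a continuous surjection $\pi:X^{-\omega}\to K$ (necessarily unique) with $F_i(\pi(\ldots x_2x_1))=\pi(\ldots x_2x_1i)$ for all $i\in X$ and all $\ldots x_2x_1\in X^{-\omega}$. With the shift $\sigma(\ldots x_2x_1)=\ldots x_3x_2$, its critical set is $\mathcal C=\pi^{-1}\bigl(\bigcup_{i\ne j}F_i(K)\cap F_j(K)\bigr)$ and its post-critical set is $\mathcal P=\bigcup_{n\ge1}\sigma^n(\mathcal C)$; the structure is p.c.f. (post-critically finite) if $\mathcal P$ is finite. Then the following are equivalent: (a) the limit space $\mathcal J_G$ is compact and metrizable and has a p.c.f. self-similar structure whose associated surjection $\pi$ is the quotient map $p$; (b) both of the following hold: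 (i) for every left-infinite path $\ldots e_2e_1$ in the Moore diagram of $\mathcal N$ ending at a state $\ne1$ and every $w\in X^*$, there is a left-infinite path $\ldots f_2f_1$ in the Moore diagram of $\mathcal N$, ending at some state $g$, such that $f_n$ has the same label as $e_n$ for every $n\ge1$ and $g(w)=w$; (ii) (the action is p.c.f.) only finitely many left-infinite paths in the Moore diagram of $\mathcal N$ end at a state $\ne1$. -/

import Mathlib

namespace SelfSim

/-! ### Words, the rooted tree and self-similar actions

A finite word `x_n … x_2 x_1` is the list `[x_n, …, x_2, x_1]` (leftmost letter first).
A left-infinite word `… x_3 x_2 x_1` is the function `n ↦ x_{n+1}`. -/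

/-- The rooted tree of finite words: a word `u` is joined to each of its one-letter extensions
`ux`; the subtree below a word `v` consists of the words that begin with `v`. -/
def wordTree (X : Type*) : SimpleGraph (List X) where
  Adj u v := (∃ x, v = u ++ [x]) ∨ (∃ x, u = v ++ [x])
  symm := ⟨fun _ _ h => h.symm⟩
  loopless := ⟨by
    rintro u (⟨x, h⟩ | ⟨x, h⟩) <;> simpa using congrArg List.length h⟩

/-- A self-similar (state-closed) action of the group `G` on the tree of finite words over `X`:
a faithful action by automorphisms of the rooted tree such that for all `g` and `x` there are `y`
and `h` with `g (x w) = y h(w)` for all words `w`. -/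
class SelfSimilarAction (G X : Type*) [Group G] [MulAction G (List X)] : Prop
    extends FaithfulSMul G (List X) where
  smul_nil : ∀ g : G, g • ([] : List X) = []
  smul_adj : ∀ (g : G) (u v : List X), (wordTree X).Adj u v → (wordTree X).Adj (g • u) (g • v)
  exists_restr : ∀ (g : G) (x : X), ∃ (y : X) (h : G), ∀ w : List X, g • (x :: w) = y :: h • w

section Action

variable {G X : Type*} [Group G] [MulAction G (List X)] [SelfSimilarAction G X]

/-- The image `g(x)` of a letter (the root permutation of `g`). -/
noncomputable def rootPerm (g : G) (x : X) : X :=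
  (SelfSimilarAction.exists_restr g x).choose

/-- The restriction `g|_x` of `g` at a letter. -/
noncomputable def restr (g : G) (x : X) : G :=
  (SelfSimilarAction.exists_restr g x).choose_spec.choose

theorem smul_cons (g : G) (x : X) (w : List X) :
    g • (x :: w) = rootPerm g x :: restr g x • w :=
  (SelfSimilarAction.exists_restr g x).choose_spec.choose_spec w

/-- The restriction `g|_v` of `g` at a finite word, with `g|_∅ = g` and `g|_{xv} = (g|_x)|_v`. -/
noncomputable def restrWord (g : G) : List X → G
  | [] => g
  | x :: v => restrWord (restr g x) v

/-- `g (v w) = g(v) g|_v (w)`. -/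
theorem smul_append (g : G) (v w : List X) :
    g • (v ++ w) = g • v ++ restrWord g v • w := by
  induction v generalizing g with
  | nil => simp [restrWord, SelfSimilarAction.smul_nil]
  | cons x v ih => simp [restrWord, smul_cons, ih]

end Action

/-! ### Contracting actions and the nucleus -/

/-- `N` is a finite set of elements of `G` such that each `g` has all its restrictions at
sufficiently long words in `N`. -/
def IsAbsorbing (G X : Type*) [Group G] [MulAction G (List X)] [SelfSimilarAction G X]
    (N : Set G) : Prop :=
  N.Finite ∧ ∀ g : G, ∃ k : ℕ, ∀ w : List X, k ≤ w.length → restrWord g w ∈ N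

/-- The action is contracting. -/
def IsContracting (G X : Type*) [Group G] [MulAction G (List X)] [SelfSimilarAction G X] : Prop :=
  ∃ N : Set G, IsAbsorbing G X N

/-- The nucleus: the smallest absorbing finite set (see `isLeast_nucleus`). -/
def nucleus (G X : Type*) [Group G] [MulAction G (List X)] [SelfSimilarAction G X] : Set G :=
  ⋂₀ {N | IsAbsorbing G X N}

theorem isLeast_nucleus {G X : Type*} [Group G] [MulAction G (List X)] [SelfSimilarAction G X]
    (h : IsContracting G X) : IsLeast {N | IsAbsorbing G X N} (nucleus G X) := by
  classical
  refine ⟨?_, fun N hN => Set.sInter_subset_of_mem hN⟩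
  obtain ⟨M, hM⟩ := h
  refine ⟨hM.1.subset (Set.sInter_subset_of_mem hM), fun g => ?_⟩
  have key : ∀ a : G, ∃ k : ℕ, ∀ w : List X, k ≤ w.length → restrWord g w = a →
      a ∈ nucleus G X := by
    intro a
    by_cases ha : a ∈ nucleus G X
    · exact ⟨0, fun _ _ _ => ha⟩
    · simp only [nucleus, Set.mem_sInter, not_forall] at ha
      obtain ⟨N, hN, haN⟩ := ha
      obtain ⟨k, hk⟩ := hN.2 g
      exact ⟨k, fun w hw e => absurd (e ▸ hk w hw) haN⟩
  choose K hK using key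
  obtain ⟨k₀, hk₀⟩ := hM.2 g
  refine ⟨max k₀ (hM.1.toFinset.sup K), fun w hw => ?_⟩
  have hm := hk₀ w (le_trans (le_max_left _ _) hw)
  refine hK (restrWord g w) w (le_trans ?_ (le_trans (le_max_right _ _) hw)) rfl
  exact Finset.le_sup (f := K) (hM.1.mem_toFinset.2 hm)

/-- A left-infinite path `… e_2 e_1` in the Moore diagram of the nucleus. It passes through the
states `… g_2 g_1 g_0` of the nucleus (`state n` is `g_n`); the edge `e_{n+1}` starts at `g_{n+1}`,
is the one given by the letter `x_{n+1}` (`letter n`), and so leads to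
`g_n = g_{n+1}|_{x_{n+1}}`. The path ends at the state `g_0`. -/
@[ext]
structure LeftPath (G X : Type*) [Group G] [MulAction G (List X)] [SelfSimilarAction G X] where
  state : ℕ → G
  letter : ℕ → X
  state_mem : ∀ n, state n ∈ nucleus G X
  step : ∀ n, restr (state (n + 1)) (letter n) = state n

/-- The label `(x_{n+1}, g_{n+1}(x_{n+1}))` of the edge `e_{n+1}`. -/
noncomputable def LeftPath.label {G X : Type*} [Group G] [MulAction G (List X)]
    [SelfSimilarAction G X] (e : LeftPath G X) (n : ℕ) : X × X :=
  (e.letter n, rootPerm (e.state (n + 1)) (e.letter n))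

/-- For each left-infinite path in the nucleus ending at a non-trivial state and each finite word
`w` there is a left-infinite path in the nucleus with the same labels that ends at a state
fixing `w`. -/
def LabelFixingCondition (G X : Type*) [Group G] [MulAction G (List X)]
    [SelfSimilarAction G X] : Prop :=
  ∀ e : LeftPath G X, e.state 0 ≠ 1 → ∀ w : List X,
    ∃ f : LeftPath G X, (∀ n, f.label n = e.label n) ∧ f.state 0 • w = w

/-- The action is post-critically finite: only finitely many left-infinite paths in the Moore
diagram of the nucleus end at a non-trivial state. -/
def IsPCFAction (G X : Type*) [Group G] [MulAction G (List X)] [SelfSimilarAction G X] : Prop :=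
  {e : LeftPath G X | e.state 0 ≠ 1}.Finite

/-! ### Left-infinite words and the limit space -/

/-- Left-infinite words `… x_2 x_1`; the value at `n` is `x_{n+1}`. -/
def LeftWord (X : Type*) : Type _ := ℕ → X

/-- The product topology, for the discrete topology on the alphabet. -/
instance (X : Type*) : TopologicalSpace (LeftWord X) :=
  @Pi.topologicalSpace ℕ (fun _ => X) (fun _ => ⊥)

namespace LeftWord

variable {X : Type*}

/-- `… x_2 x_1 ↦ … x_2 x_1 i`. -/
def snoc (w : LeftWord X) (i : X) : LeftWord X
  | 0 => i
  | n + 1 => w n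

/-- The shift `… x_2 x_1 ↦ … x_3 x_2`. -/
def shift (w : LeftWord X) : LeftWord X := fun n => w (n + 1)

/-- The finite word `x_k … x_2 x_1`. -/
def suffix (w : LeftWord X) : ℕ → List X
  | 0 => []
  | k + 1 => w k :: suffix w k

end LeftWord

/-- Asymptotic equivalence of left-infinite words. -/
def AsympEquiv (G : Type*) {X : Type*} [Group G] [MulAction G (List X)]
    (x y : LeftWord X) : Prop :=
  ∃ g : ℕ → G, (Set.range g).Finite ∧ ∀ k, 1 ≤ k → g k • x.suffix k = y.suffix k

/-- Asymptotic equivalence as a setoid. -/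
def asympSetoid (G X : Type*) [Group G] [MulAction G (List X)] : Setoid (LeftWord X) where
  r := AsympEquiv G
  iseqv :=
    { refl := fun x => ⟨fun _ => 1, Set.finite_range_const, fun k _ => one_smul _ _⟩
      symm := by
        rintro x y ⟨g, hg, h⟩
        refine ⟨fun k => (g k)⁻¹, (hg.image fun a => a⁻¹).subset ?_, fun k hk => ?_⟩
        · rintro _ ⟨k, rfl⟩
          exact ⟨g k, ⟨k, rfl⟩, rfl⟩
        · rw [← h k hk, inv_smul_smul]
      trans := by
        rintro x y z ⟨g, hg, h⟩ ⟨g₂, hg₂, h₂⟩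
        refine ⟨fun k => g₂ k * g k, (hg₂.image2 (· * ·) hg).subset ?_, fun k hk => ?_⟩
        · rintro _ ⟨k, rfl⟩
          exact ⟨g₂ k, ⟨k, rfl⟩, g k, ⟨k, rfl⟩, rfl⟩
        · rw [mul_smul, h k hk, h₂ k hk] }

/-- The limit space: left-infinite words modulo asymptotic equivalence. -/
def LimitSpace (G X : Type*) [Group G] [MulAction G (List X)] : Type _ :=
  Quotient (asympSetoid G X)

/-- The quotient map onto the limit space. -/
def LimitSpace.proj (G X : Type*) [Group G] [MulAction G (List X)] :
    LeftWord X → LimitSpace G X :=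
  Quotient.mk (asympSetoid G X)

/-- The quotient topology. -/
instance (G X : Type*) [Group G] [MulAction G (List X)] : TopologicalSpace (LimitSpace G X) :=
  TopologicalSpace.coinduced (LimitSpace.proj G X) inferInstance

/-! ### Self-similar structures -/

/-- A self-similar structure `(K, X, {F_i})` on `K`, together with its associated continuous
surjection `π`. -/
structure SelfSimilarStructure (X K : Type*) [TopologicalSpace K] where
  compactSpace : CompactSpace K
  metrizableSpace : TopologicalSpace.MetrizableSpace K
  F : X → K → K
  continuous_F : ∀ i, Continuous (F i)
  injective_F : ∀ i, Function.Injective (F i)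
  π : LeftWord X → K
  continuous_π : Continuous π
  surjective_π : Function.Surjective π
  F_π : ∀ i w, F i (π w) = π (w.snoc i)

namespace SelfSimilarStructure

variable {X K : Type*} [TopologicalSpace K] (L : SelfSimilarStructure X K)

/-- The critical set `π⁻¹ (⋃_{i ≠ j} K_i ∩ K_j)` with `K_i = F_i(K)`. -/
def criticalSet : Set (LeftWord X) :=
  L.π ⁻¹' ⋃ (i : X) (j : X) (_ : i ≠ j), Set.range (L.F i) ∩ Set.range (L.F j)

/-- The post-critical set `⋃_{n ≥ 1} σ^n(C)`. -/
def postCriticalSet : Set (LeftWord X) :=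
  ⋃ (n : ℕ) (_ : 1 ≤ n), (LeftWord.shift^[n]) '' L.criticalSet

/-- The structure is post-critically finite. -/
def IsPCF : Prop := L.postCriticalSet.Finite

end SelfSimilarStructure

end SelfSim

open Set Filter Topology

/-! ### Images under closed maps -/

/-! Everything is translated into paths in the nucleus: two words are asymptotically equivalent iff
they are the two label words of one left-infinite path (`LeftPath.asympEquiv`,
`AsympEquiv.exists_leftPath`). The relation is then closed, so the limit space is compact and
metrizable.

With `π = p`, the map `F i` must send the class of `x` to that of `xi`, so it exists iff appending a
common letter preserves equivalence; by `labelFixingCondition_iff` this is condition (i).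
Injectivity is automatic, as deleting the last edge of a path deletes the last letters of its label
words.

The post-critical set consists of the sources of the paths ending at a non-trivial state
(`postCriticalSet_eq`). Each word is the source of finitely many paths
(`LeftPath.finite_setOf_source_eq`), so the two finiteness conditions agree. -/

theorem t2Space_of_isClosedMap {A B : Type*} [TopologicalSpace A] [TopologicalSpace B]
    [NormalSpace A] [T1Space A] {f : A → B} (hf : IsClosedMap f) (hc : Continuous f)
    (hs : Function.Surjective f) : T2Space B := by
  have hpt : ∀ b : B, IsClosed (f ⁻¹' {b}) := fun b => by
    obtain ⟨a, rfl⟩ := hs b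
    have h := hf {a} isClosed_singleton
    rw [image_singleton] at h
    exact h.preimage hc
  refine ⟨fun b c hbc => ?_⟩
  obtain ⟨U, W, hU, hW, hbU, hcW, hUW⟩ := normal_separation (hpt b) (hpt c)
    (Disjoint.preimage f (by simpa using hbc))
  rw [isClosedMap_iff_kernImage] at hf
  refine ⟨_, _, hf hU, hf hW, fun a ha => hbU ha, fun a ha => hcW ha, ?_⟩
  rw [disjoint_left]
  intro d hd hd'
  obtain ⟨a, rfl⟩ := hs d
  exact disjoint_left.1 hUW (hd rfl) (hd' rfl)

/-- A compact fibre inside an open set is covered by finitely many basic open sets, so the kernel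
images of finite unions of basic sets form a countable basis. -/
theorem secondCountableTopology_of_isClosedMap {A B : Type*} [TopologicalSpace A]
    [TopologicalSpace B] [CompactSpace A] [SecondCountableTopology A] [T1Space B]
    {f : A → B} (hf : IsClosedMap f) (hc : Continuous f) (hs : Function.Surjective f) :
    SecondCountableTopology B := by
  have hb := TopologicalSpace.isBasis_countableBasis A
  have hcount := TopologicalSpace.countable_countableBasis A
  rw [isClosedMap_iff_kernImage] at hf
  have hB : TopologicalSpace.IsTopologicalBasis
      ((fun S : Set (Set A) => kernImage f (⋃₀ S)) ''
        {S | S.Finite ∧ S ⊆ TopologicalSpace.countableBasis A}) := by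
    refine TopologicalSpace.isTopologicalBasis_of_isOpen_of_nhds ?_ ?_
    · rintro _ ⟨S, ⟨-, hS⟩, rfl⟩
      exact hf (isOpen_sUnion fun s hs => hb.isOpen (hS hs))
    · intro b V hbV hV
      have hK : IsCompact (f ⁻¹' {b}) := (isClosed_singleton.preimage hc).isCompact
      obtain ⟨S, hS, hSf, hcov⟩ := hK.elim_finite_subcover_image
        (b := {s | s ∈ TopologicalSpace.countableBasis A ∧ s ⊆ f ⁻¹' V}) (c := id)
        (fun s h => hb.isOpen h.1) (fun a ha => by
          obtain ⟨s, hs, has, hsV⟩ := hb.exists_subset_of_mem_open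
            (show a ∈ f ⁻¹' V by simpa [show f a = b from ha] using hbV) (hV.preimage hc)
          exact mem_biUnion (show s ∈ {s | _ ∧ _} from ⟨hs, hsV⟩) has)
      simp only [id, ← sUnion_eq_biUnion] at hcov
      refine ⟨_, ⟨S, ⟨hSf, fun s hs => (hS hs).1⟩, rfl⟩, fun a ha => hcov ha, fun c hcS => ?_⟩
      obtain ⟨a, rfl⟩ := hs c
      obtain ⟨s, hsS, has⟩ := hcS rfl
      exact (hS hsS).2 has
  exact hB.secondCountableTopology ((countable_ofPred_finite_subset hcount).image _)

namespace SelfSim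

/-! ### Left-infinite words -/

namespace LeftWord

variable {X : Type*}

instance [Finite X] : CompactSpace (LeftWord X) := by
  let : TopologicalSpace X := ⊥
  exact inferInstanceAs (CompactSpace (ℕ → X))

instance : T2Space (LeftWord X) := by
  let : TopologicalSpace X := ⊥
  have : DiscreteTopology X := ⟨rfl⟩
  exact inferInstanceAs (T2Space (ℕ → X))

instance [Finite X] : SecondCountableTopology (LeftWord X) := by
  let : TopologicalSpace X := ⊥
  have : DiscreteTopology X := ⟨rfl⟩
  exact inferInstanceAs (SecondCountableTopology (ℕ → X))

theorem isOpen_setOf_apply_eq (n : ℕ) (i : X) : IsOpen {w : LeftWord X | w n = i} := by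
  let : TopologicalSpace X := ⊥
  have : DiscreteTopology X := ⟨rfl⟩
  exact (isOpen_discrete {i}).preimage (continuous_apply (A := fun _ : ℕ => X) n)

theorem isOpen_setOf_suffix_eq (n : ℕ) (l : List X) :
    IsOpen {w : LeftWord X | w.suffix n = l} := by
  induction n generalizing l with
  | zero => exact isOpen_const (p := [] = l)
  | succ n ih =>
    cases l with
    | nil => simp [suffix]
    | cons i l =>
      simp only [suffix, List.cons.injEq]
      exact (isOpen_setOf_apply_eq n i).inter (ih l)

theorem continuous_snoc (i : X) : Continuous fun w : LeftWord X => w.snoc i := by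
  let : TopologicalSpace X := ⊥
  refine continuous_pi (A := fun _ : ℕ => X) fun n => ?_
  cases n with
  | zero => exact continuous_const
  | succ n => exact continuous_apply (A := fun _ : ℕ => X) n

/-- Left-infinite words followed by a finite word. -/
def append (w : LeftWord X) : List X → LeftWord X
  | [] => w
  | i :: l => append (w.snoc i) l

theorem append_concat (w : LeftWord X) (l : List X) (i : X) :
    w.append (l ++ [i]) = (w.append l).snoc i := by
  induction l generalizing w with
  | nil => rfl
  | cons j l ih => exact ih _

theorem shift_snoc (w : LeftWord X) (i : X) : (w.snoc i).shift = w := rfl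

theorem snoc_shift (w : LeftWord X) : w.shift.snoc (w 0) = w := by
  funext n
  cases n <;> rfl

theorem iterate_shift_append (w : LeftWord X) (l : List X) :
    shift^[l.length] (w.append l) = w := by
  induction l generalizing w with
  | nil => rfl
  | cons i l ih =>
    rw [List.length_cons, Function.iterate_succ_apply', append, ih, shift_snoc]

theorem iterate_shift_apply (w : LeftWord X) (n k : ℕ) : shift^[n] w k = w (k + n) := by
  induction n generalizing w with
  | zero => rfl
  | succ n ih => rw [Function.iterate_succ_apply, ih]; rfl

theorem suffix_length (w : LeftWord X) (n : ℕ) : (w.suffix n).length = n := by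
  induction n with
  | zero => rfl
  | succ n ih => simp [suffix, ih]

theorem suffix_add (w : LeftWord X) (n k : ℕ) :
    w.suffix (k + n) = (shift^[n] w).suffix k ++ w.suffix n := by
  induction k with
  | zero => simp [suffix]
  | succ k ih => rw [Nat.add_right_comm, suffix, suffix, ih, iterate_shift_apply]; rfl

theorem suffix_succ_eq_shift (w : LeftWord X) (k : ℕ) :
    w.suffix (k + 1) = w.shift.suffix k ++ [w 0] := w.suffix_add 1 k

end LeftWord

/-! ### Restrictions -/

section Restr

variable {G X : Type*} [Group G] [MulAction G (List X)] [SelfSimilarAction G X]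

theorem rootPerm_one (x : X) : rootPerm (1 : G) x = x := by
  have h := smul_cons (1 : G) x []
  rw [one_smul] at h
  exact (List.cons.inj h).1.symm

theorem restr_one (x : X) : restr (1 : G) x = 1 := by
  refine FaithfulSMul.eq_of_smul_eq_smul (α := List X) fun w => ?_
  have h := smul_cons (1 : G) x w
  rw [one_smul] at h
  rw [one_smul, ← (List.cons.inj h).2]

theorem restrWord_append (g : G) (v w : List X) :
    restrWord g (v ++ w) = restrWord (restrWord g v) w := by
  induction v generalizing g with
  | nil => rfl
  | cons x v ih => exact ih _

theorem smul_length (g : G) (v : List X) : (g • v).length = v.length := by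
  induction v generalizing g with
  | nil => simp [SelfSimilarAction.smul_nil]
  | cons x v ih => simp [smul_cons, ih]

/-- By faithfulness some word is moved; cut it just before the first letter that changes. -/
theorem exists_rootPerm_restrWord_ne {g : G} (hg : g ≠ 1) :
    ∃ (s : List X) (i : X), g • s = s ∧ rootPerm (restrWord g s) i ≠ i := by
  have key : ∀ (u : List X) (g : G), g • u ≠ u →
      ∃ (s : List X) (i : X), g • s = s ∧ rootPerm (restrWord g s) i ≠ i := by
    intro u
    induction u with
    | nil => exact fun g h => absurd (SelfSimilarAction.smul_nil g) h
    | cons x u ih =>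
      intro g h
      by_cases hx : rootPerm g x = x
      · obtain ⟨s, i, hs, hi⟩ := ih (restr g x) fun h' => h (by rw [smul_cons, hx, h'])
        exact ⟨x :: s, i, by rw [smul_cons, hx, hs], hi⟩
      · exact ⟨[], x, SelfSimilarAction.smul_nil g, hx⟩
  by_contra! hcon
  refine hg (FaithfulSMul.eq_of_smul_eq_smul (α := List X) fun u => ?_)
  by_contra hu
  rw [one_smul] at hu
  obtain ⟨s, i, hs, hi⟩ := key u g hu
  exact hi (hcon s i hs)

/-- The elements of the nucleus whose letter restrictions stay in it already form an absorbing set,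
so minimality applies. -/
theorem restr_mem_nucleus (hc : IsContracting G X) {g : G} (hg : g ∈ nucleus G X) (x : X) :
    restr g x ∈ nucleus G X := by
  obtain ⟨⟨hfin, habs⟩, -⟩ := isLeast_nucleus hc
  have hN : IsAbsorbing G X {a ∈ nucleus G X | ∀ x : X, restr a x ∈ nucleus G X} := by
    refine ⟨hfin.subset fun a ha => ha.1, fun a => ?_⟩
    obtain ⟨k, hk⟩ := habs a
    refine ⟨k, fun w hw => ⟨hk w hw, fun x => ?_⟩⟩
    have h := hk (w ++ [x]) (by simp; omega)
    rwa [restrWord_append] at h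
  exact ((isLeast_nucleus hc).2 hN hg).2 x

end Restr

/-! ### Paths and asymptotic equivalence -/

namespace LeftPath

variable {G X : Type*} [Group G] [MulAction G (List X)] [SelfSimilarAction G X]

/-- The left-infinite word read off the first components of the labels. -/
def source (e : LeftPath G X) : LeftWord X := e.letter

/-- The left-infinite word read off the second components of the labels. -/
noncomputable def target (e : LeftPath G X) : LeftWord X :=
  fun n => rootPerm (e.state (n + 1)) (e.letter n)

theorem label_eq (e : LeftPath G X) (n : ℕ) : e.label n = (e.source n, e.target n) := rfl

theorem forall_label_eq_iff (e f : LeftPath G X) :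
    (∀ n, f.label n = e.label n) ↔ f.source = e.source ∧ f.target = e.target := by
  simp only [label_eq, Prod.mk.injEq, forall_and]
  exact and_congr funext_iff.symm funext_iff.symm

theorem state_smul_suffix (e : LeftPath G X) (n : ℕ) :
    e.state n • e.source.suffix n = e.target.suffix n := by
  induction n with
  | zero => exact SelfSimilarAction.smul_nil _
  | succ n ih =>
    rw [LeftWord.suffix, LeftWord.suffix, smul_cons, ← ih]
    congr 2
    exact e.step n

/-- The path prolonged by the edge with a given letter. -/
noncomputable def extend (hc : IsContracting G X) (e : LeftPath G X) (i : X) :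
    LeftPath G X where
  state
    | 0 => restr (e.state 0) i
    | n + 1 => e.state n
  letter
    | 0 => i
    | n + 1 => e.letter n
  state_mem
    | 0 => restr_mem_nucleus hc (e.state_mem 0) i
    | n + 1 => e.state_mem n
  step
    | 0 => rfl
    | n + 1 => e.step n

theorem source_extend (hc : IsContracting G X) (e : LeftPath G X) (i : X) :
    (e.extend hc i).source = e.source.snoc i := by
  funext n
  cases n <;> rfl

theorem target_extend (hc : IsContracting G X) (e : LeftPath G X) (i : X) :
    (e.extend hc i).target = e.target.snoc (rootPerm (e.state 0) i) := by
  funext n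
  cases n <;> rfl

theorem exists_append (hc : IsContracting G X) (e : LeftPath G X) (s : List X) :
    ∃ f : LeftPath G X, f.source = e.source.append s ∧
      f.target = e.target.append (e.state 0 • s) ∧ f.state 0 = restrWord (e.state 0) s := by
  induction s generalizing e with
  | nil => exact ⟨e, rfl, by rw [SelfSimilarAction.smul_nil]; rfl, rfl⟩
  | cons i s ih =>
    obtain ⟨f, h₁, h₂, h₃⟩ := ih (e.extend hc i)
    refine ⟨f, ?_, ?_, h₃⟩
    · rw [h₁, source_extend]; rfl
    · rw [h₂, target_extend, smul_cons]; rfl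

/-- The path with its last edge removed. -/
def tail (e : LeftPath G X) : LeftPath G X where
  state n := e.state (n + 1)
  letter n := e.letter (n + 1)
  state_mem n := e.state_mem (n + 1)
  step n := e.step (n + 1)

theorem source_tail (e : LeftPath G X) : e.tail.source = e.source.shift := rfl

theorem target_tail (e : LeftPath G X) : e.tail.target = e.target.shift := rfl

theorem state_tail_ne_one {e : LeftPath G X} (h : e.state 0 ≠ 1) : e.tail.state 0 ≠ 1 := by
  intro h'
  apply h
  rw [← e.step 0, show e.state (0 + 1) = 1 from h', restr_one]

/-- Converse to `exists_append`: removing the last `s.length` edges exposes a state that must carry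
`s` to `t`. -/
theorem exists_tail_append (s : List X) : ∀ (e : LeftPath G X) (x y : LeftWord X)
    (t : List X), t.length = s.length → e.source = x.append s → e.target = y.append t →
    ∃ f : LeftPath G X, f.source = x ∧ f.target = y ∧ f.state 0 • s = t := by
  induction s with
  | nil =>
    intro e x y t ht hx hy
    obtain rfl := List.length_eq_zero_iff.1 ht
    exact ⟨e, hx, hy, SelfSimilarAction.smul_nil _⟩
  | cons i s ih =>
    intro e x y t ht hx hy
    cases t with
    | nil => simp at ht
    | cons j t =>
      obtain ⟨f, h₁, h₂, h₃⟩ := ih e (x.snoc i) (y.snoc j) t (by simpa using ht) hx hy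
      refine ⟨f.tail, ?_, ?_, ?_⟩
      · rw [source_tail, h₁, LeftWord.shift_snoc]
      · rw [target_tail, h₂, LeftWord.shift_snoc]
      · have hi : f.letter 0 = i := congrFun h₁ 0
        have hj : rootPerm (f.state 1) (f.letter 0) = j := congrFun h₂ 0
        have hs : restr (f.state 1) (f.letter 0) = f.state 0 := f.step 0
        rw [hi] at hj hs
        change f.state 1 • (i :: s) = _
        rw [smul_cons, hj, hs, h₃]

/-- Once the letters are fixed, each state determines all later ones on the path. Distinct paths
therefore differ at every sufficiently large index, and there are at most as many as states in the
nucleus. -/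
theorem finite_setOf_source_eq (hc : IsContracting G X) (x : LeftWord X) :
    {e : LeftPath G X | e.source = x}.Finite := by
  have hN := (isLeast_nucleus hc).1.1
  by_contra hinf
  obtain ⟨T, hT, hcard⟩ := Set.Infinite.exists_subset_card_eq hinf (hN.toFinset.card + 1)
  have hsep : ∀ e f : LeftPath G X, e.source = x → f.source = x → e ≠ f →
      ∃ n, e.state n ≠ f.state n := by
    intro e f he hf hne
    by_contra! h
    exact hne (LeftPath.ext (funext h) (he.trans hf.symm))
  have hpers : ∀ e f : LeftPath G X, e.source = x → f.source = x → ∀ n k,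
      e.state (n + k) = f.state (n + k) → e.state n = f.state n := by
    intro e f he hf n k
    induction k with
    | zero => exact id
    | succ k ih =>
      intro h
      refine ih ?_
      rw [← e.step, ← f.step, show e.letter = f.letter from he.trans hf.symm]
      exact congrArg (restr · _) h
  have hev : ∀ p : LeftPath G X × LeftPath G X, p ∈ T.offDiag →
      ∀ᶠ n in atTop, p.1.state n ≠ p.2.state n := by
    rintro ⟨e, f⟩ hp
    rw [Finset.mem_offDiag] at hp
    obtain ⟨n, hn⟩ := hsep e f (hT hp.1) (hT hp.2.1) hp.2.2
    filter_upwards [eventually_ge_atTop n] with m hm h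
    obtain ⟨k, rfl⟩ := Nat.exists_eq_add_of_le hm
    exact hn (hpers e f (hT hp.1) (hT hp.2.1) n k h)
  obtain ⟨n, hn⟩ := ((Finset.eventually_all T.offDiag).2 hev).exists
  have hle : T.card ≤ hN.toFinset.card := by
    refine Finset.card_le_card_of_injOn (fun e => e.state n)
      (fun e _ => hN.mem_toFinset.2 (e.state_mem n)) fun e he f hf hef => ?_
    by_contra hne
    exact hn (e, f) (Finset.mem_offDiag.2 ⟨he, hf, hne⟩) hef
  omega

end LeftPath

/-! ### Asymptotic equivalence read off paths in the nucleus -/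

section Equivalence

variable {G X : Type*} [Group G] [MulAction G (List X)] [SelfSimilarAction G X]

theorem LeftPath.asympEquiv (hc : IsContracting G X) (e : LeftPath G X) :
    AsympEquiv G e.source e.target :=
  ⟨e.state, (isLeast_nucleus hc).1.1.subset (range_subset_iff.2 e.state_mem),
    fun k _ => e.state_smul_suffix k⟩

/-- A compactness argument: the runs of `g m` on the suffixes of length `m` eventually pass through
the finite nucleus, and an ultrafilter picks a coherent limit of their states. -/
theorem AsympEquiv.exists_leftPath (hc : IsContracting G X) {x y : LeftWord X}
    (h : AsympEquiv G x y) : ∃ e : LeftPath G X, e.source = x ∧ e.target = y := by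
  obtain ⟨g, hfin, hg⟩ := h
  obtain ⟨⟨hN, habs⟩, -⟩ := isLeast_nucleus hc
  choose K hK using habs
  -- As `g` has finitely many values, one depth `M` works for all of them.
  obtain ⟨M, hM⟩ := (hfin.image K).bddAbove
  -- The state of `g (k + n)` after reading `k` letters, with `n` letters left.
  let s : ℕ → ℕ → G := fun k n => restrWord (g (k + n)) ((LeftWord.shift^[n] x).suffix k)
  let U := hyperfilter ℕ
  have hU : (U : Filter ℕ) ≤ atTop := Nat.cofinite_eq_atTop ▸ hyperfilter_le_cofinite
  have hs : ∀ k n, M ≤ k → s k n ∈ nucleus G X := fun k n hk => by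
    refine hK _ _ ?_
    rw [LeftWord.suffix_length]
    exact (hM ⟨_, ⟨k + n, rfl⟩, rfl⟩).trans hk
  have hstep : ∀ k n, restr (s k (n + 1)) (x n) = s (k + 1) n := fun k n => by
    change restr (restrWord (g (k + (n + 1))) _) _ = restrWord (g (k + 1 + n)) _
    rw [LeftWord.suffix_succ_eq_shift, restrWord_append,
      ← Function.iterate_succ_apply' LeftWord.shift,
      LeftWord.iterate_shift_apply, zero_add, show k + 1 + n = k + (n + 1) by omega]
    rfl
  have hsmul : ∀ k n, 1 ≤ k + n → s k n • x.suffix n = y.suffix n := fun k n hkn => by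
    have h := hg (k + n) hkn
    rw [LeftWord.suffix_add, LeftWord.suffix_add, smul_append] at h
    exact (List.append_inj h (by simp [smul_length, LeftWord.suffix_length])).2
  -- Here `m = k + n` is the length of the whole run; the truncation in `m - n` is harmless because
  -- `m` is eventually large.
  have hlim : ∀ n, ∃ a ∈ nucleus G X, ∀ᶠ m in (U : Filter ℕ), s (m - n) n = a := fun n => by
    refine (Ultrafilter.eventually_exists_mem_iff hN
      (P := fun a m => s (m - n) n = a)).1 (hU ?_)
    filter_upwards [eventually_ge_atTop (M + n)] with m hm
    exact ⟨_, hs _ _ (by omega), rfl⟩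
  choose a haN ha using hlim
  have hbig : ∀ n, ∀ᶠ m in (U : Filter ℕ), n ≤ m := fun n => hU (eventually_ge_atTop n)
  refine ⟨⟨a, x, haN, fun n => ?_⟩, rfl, funext fun n => ?_⟩
  · obtain ⟨m, h₁, h₂, h₃⟩ := ((ha n).and ((ha (n + 1)).and (hbig (n + 1)))).exists
    rw [← h₁, ← h₂, hstep]
    congr 1
    omega
  · obtain ⟨m, h₁, h₂⟩ := ((ha (n + 1)).and (hbig (n + 1))).exists
    have h := hsmul (m - (n + 1)) (n + 1) (by omega)
    rw [h₁, LeftWord.suffix, LeftWord.suffix, smul_cons] at h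
    exact (List.cons.inj h).1

/-- Using the fixed finite nucleus makes the relation an intersection of conditions on suffixes of
length `n`, hence closed. -/
theorem asympEquiv_iff_forall_exists_nucleus (hc : IsContracting G X) {x y : LeftWord X} :
    AsympEquiv G x y ↔ ∀ n, ∃ g ∈ nucleus G X, g • x.suffix n = y.suffix n := by
  constructor
  · intro h n
    obtain ⟨e, rfl, rfl⟩ := h.exists_leftPath hc
    exact ⟨e.state n, e.state_mem n, e.state_smul_suffix n⟩
  · intro h
    choose g hg h using h
    exact ⟨g, (isLeast_nucleus hc).1.1.subset (range_subset_iff.2 hg), fun k _ => h k⟩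

theorem isClosed_setOf_asympEquiv (hc : IsContracting G X) :
    IsClosed {p : LeftWord X × LeftWord X | AsympEquiv G p.1 p.2} := by
  simp only [asympEquiv_iff_forall_exists_nucleus hc, ofPred_forall]
  refine isClosed_iInter fun n => ⟨?_⟩
  rw [isOpen_iff_mem_nhds]
  rintro ⟨x, y⟩ hxy
  filter_upwards [prod_mem_nhds
    ((LeftWord.isOpen_setOf_suffix_eq n (x.suffix n)).mem_nhds rfl)
    ((LeftWord.isOpen_setOf_suffix_eq n (y.suffix n)).mem_nhds rfl)]
  rintro ⟨x', y'⟩ ⟨hx, hy⟩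
  simp only [mem_ofPred_eq] at hx hy
  simpa [hx, hy] using hxy

theorem AsympEquiv.of_snoc (hc : IsContracting G X) {x y : LeftWord X} {i j : X}
    (h : AsympEquiv G (x.snoc i) (y.snoc j)) : AsympEquiv G x y := by
  obtain ⟨e, hx, hy⟩ := h.exists_leftPath hc
  have := e.tail.asympEquiv hc
  rwa [LeftPath.source_tail, LeftPath.target_tail, hx, hy] at this

end Equivalence

/-! ### The limit space -/

namespace LimitSpace

variable {G X : Type*} [Group G] [MulAction G (List X)]

theorem surjective_proj : Function.Surjective (proj G X) := Quotient.mk_surjective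

theorem continuous_proj : Continuous (proj G X) := continuous_coinduced_rng

theorem proj_eq_iff {x y : LeftWord X} : proj G X x = proj G X y ↔ AsympEquiv G x y :=
  Quotient.eq (r := asympSetoid G X)

theorem compactSpace [Finite X] : CompactSpace (LimitSpace G X) :=
  surjective_proj.compactSpace continuous_proj

variable [SelfSimilarAction G X] [Finite X]

theorem isClosedMap_proj (hc : IsContracting G X) : IsClosedMap (proj G X) := by
  intro C hC
  refine isClosed_coinduced.2 ?_
  -- The saturation of `C` is a projection of a closed set along a compact factor.
  have h : proj G X ⁻¹' (proj G X '' C) =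
      Prod.snd '' ({p : LeftWord X × LeftWord X | AsympEquiv G p.1 p.2} ∩ Prod.fst ⁻¹' C) := by
    ext y
    simp only [mem_preimage, mem_image, proj_eq_iff, mem_inter_iff, mem_ofPred_eq, Prod.exists,
      exists_eq_right]
    exact exists_congr fun _ => and_comm
  rw [h]
  exact isClosedMap_snd_of_compactSpace _
    ((isClosed_setOf_asympEquiv hc).inter (hC.preimage continuous_fst))

theorem metrizableSpace (hc : IsContracting G X) :
    TopologicalSpace.MetrizableSpace (LimitSpace G X) := by
  have := compactSpace (G := G) (X := X)
  have := t2Space_of_isClosedMap (isClosedMap_proj hc) continuous_proj surjective_proj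
  have := secondCountableTopology_of_isClosedMap (isClosedMap_proj hc) continuous_proj
    surjective_proj
  infer_instance

end LimitSpace

theorem mem_criticalSet_iff {G X : Type*} [Group G] [MulAction G (List X)]
    {L : SelfSimilarStructure X (LimitSpace G X)}
    (hL : L.π = LimitSpace.proj G X) {w : LeftWord X} :
    w ∈ L.criticalSet ↔ ∃ v : LeftWord X, AsympEquiv G w v ∧ w 0 ≠ v 0 := by
  have hF : ∀ v : LeftWord X, LimitSpace.proj G X v ∈ range (L.F (v 0)) := fun v =>
    ⟨L.π v.shift, by rw [L.F_π, LeftWord.snoc_shift, hL]⟩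
  simp only [SelfSimilarStructure.criticalSet, mem_preimage, mem_iUnion, mem_inter_iff, hL]
  constructor
  · have key : ∀ i, LimitSpace.proj G X w ∈ range (L.F i) →
        ∃ v : LeftWord X, AsympEquiv G w v ∧ v 0 = i := by
      rintro i ⟨q, hq⟩
      obtain ⟨u, rfl⟩ := L.surjective_π q
      rw [L.F_π, hL] at hq
      exact ⟨u.snoc i, LimitSpace.proj_eq_iff.1 hq.symm, rfl⟩
    rintro ⟨i, j, hij, hi, hj⟩
    by_cases h : w 0 = i
    · obtain ⟨v, hv, hv0⟩ := key j hj
      exact ⟨v, hv, by rwa [h, hv0]⟩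
    · obtain ⟨v, hv, hv0⟩ := key i hi
      exact ⟨v, hv, by rwa [hv0]⟩
  · rintro ⟨v, hv, hne⟩
    exact ⟨w 0, v 0, hne, hF w, LimitSpace.proj_eq_iff.2 hv ▸ hF v⟩

/-! ### The self-similar structure and its post-critical set -/

section Structure

variable {G X : Type*} [Group G] [MulAction G (List X)] [SelfSimilarAction G X]

/-- A path with edge labels `(i, i)` for the letters `i` of `w` appended is the same as a path whose
end state fixes `w`. One-letter words suffice in one direction; iteration gives the other. -/
theorem labelFixingCondition_iff (hc : IsContracting G X) :
    LabelFixingCondition G X ↔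
      ∀ (x y : LeftWord X) (i : X), AsympEquiv G x y → AsympEquiv G (x.snoc i) (y.snoc i) := by
  constructor
  · intro H x y i h
    obtain ⟨e, rfl, rfl⟩ := h.exists_leftPath hc
    obtain ⟨f, hs, ht, hi⟩ : ∃ f : LeftPath G X,
        f.source = e.source ∧ f.target = e.target ∧ rootPerm (f.state 0) i = i := by
      by_cases h1 : e.state 0 = 1
      · exact ⟨e, rfl, rfl, by rw [h1, rootPerm_one]⟩
      · obtain ⟨f, hf, hfi⟩ := H e h1 [i]
        rw [smul_cons] at hfi
        obtain ⟨hs, ht⟩ := (LeftPath.forall_label_eq_iff e f).1 hf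
        exact ⟨f, hs, ht, (List.cons.inj hfi).1⟩
    have := (f.extend hc i).asympEquiv hc
    rwa [LeftPath.source_extend, LeftPath.target_extend, hi, hs, ht] at this
  · intro H e _ w
    have happ : AsympEquiv G (e.source.append w) (e.target.append w) := by
      generalize e.source = x, e.target = y, e.asympEquiv hc = h
      induction w generalizing x y with
      | nil => exact h
      | cons i w ih => exact ih _ _ (H x y i h)
    obtain ⟨f, hs, ht⟩ := happ.exists_leftPath hc
    obtain ⟨f', hs', ht', hw⟩ := f.exists_tail_append w _ _ _ rfl hs ht
    exact ⟨f', (LeftPath.forall_label_eq_iff e f').2 ⟨hs', ht'⟩, hw⟩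

/-- The self-similar structure on the limit space. -/
noncomputable def limitStructure [Finite X] (hc : IsContracting G X)
    (H : LabelFixingCondition G X) : SelfSimilarStructure X (LimitSpace G X) where
  compactSpace := LimitSpace.compactSpace
  metrizableSpace := LimitSpace.metrizableSpace hc
  F i := Quotient.lift (fun w => LimitSpace.proj G X (w.snoc i)) fun x y h =>
    LimitSpace.proj_eq_iff.2 ((labelFixingCondition_iff hc).1 H x y i h)
  continuous_F i := continuous_coinduced_dom.2
    (LimitSpace.continuous_proj.comp (LeftWord.continuous_snoc i))
  injective_F i := by
    rintro ⟨x⟩ ⟨y⟩ h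
    exact LimitSpace.proj_eq_iff.2 ((LimitSpace.proj_eq_iff.1 h).of_snoc hc)
  π := LimitSpace.proj G X
  continuous_π := LimitSpace.continuous_proj
  surjective_π := LimitSpace.surjective_proj
  F_π _ _ := rfl

/-- A critical word labels a path whose last edge has two different letters, so that edge starts at
a non-trivial state. Conversely, a path ending at a non-trivial state extends until such an edge
occurs. -/
theorem postCriticalSet_eq (hc : IsContracting G X)
    {L : SelfSimilarStructure X (LimitSpace G X)} (hL : L.π = LimitSpace.proj G X) :
    L.postCriticalSet = LeftPath.source '' {e : LeftPath G X | e.state 0 ≠ 1} := by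
  ext u
  simp only [SelfSimilarStructure.postCriticalSet, mem_iUnion, mem_image, exists_prop,
    mem_ofPred_eq, mem_criticalSet_iff hL]
  constructor
  · rintro ⟨n, hn, w, ⟨v, hwv, hne⟩, rfl⟩
    obtain ⟨e, rfl, rfl⟩ := hwv.exists_leftPath hc
    obtain ⟨n, rfl⟩ := Nat.exists_eq_add_of_le' hn
    induction n with
    | zero =>
      refine ⟨e.tail, fun h => hne ?_, rfl⟩
      change e.letter 0 = rootPerm (e.state 1) (e.letter 0)
      rw [show e.state 1 = 1 from h, rootPerm_one]
    | succ n ih =>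
      obtain ⟨f, hf, hfs⟩ := ih (by omega)
      -- Shifting further keeps the end state non-trivial, since restrictions of `1` are `1`.
      refine ⟨f.tail, LeftPath.state_tail_ne_one hf, ?_⟩
      rw [LeftPath.source_tail, hfs, ← Function.iterate_succ_apply' LeftWord.shift]
  · rintro ⟨e, he, rfl⟩
    obtain ⟨s, i, hs, hi⟩ := exists_rootPerm_restrWord_ne (X := X) he
    obtain ⟨f, h₁, h₂, h₃⟩ := e.exists_append hc (s ++ [i])
    refine ⟨(s ++ [i]).length, by simp, _, ⟨f.target, h₁ ▸ f.asympEquiv hc, ?_⟩,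
      e.source.iterate_shift_append _⟩
    rw [h₂, smul_append, hs, smul_cons, SelfSimilarAction.smul_nil, LeftWord.append_concat,
      LeftWord.append_concat]
    exact hi.symm

theorem isPCF_iff (hc : IsContracting G X)
    {L : SelfSimilarStructure X (LimitSpace G X)} (hL : L.π = LimitSpace.proj G X) :
    L.IsPCF ↔ IsPCFAction G X := by
  rw [SelfSimilarStructure.IsPCF, postCriticalSet_eq hc hL, IsPCFAction]
  refine ⟨fun h => ?_, fun h => h.image _⟩
  refine (h.preimage' (f := LeftPath.source)
    fun x _ => LeftPath.finite_setOf_source_eq hc x).subset fun e he => mem_image_of_mem _ he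

end Structure

end SelfSim

theorem mainTheorem5 {G X : Type*} [Finite X] [Group G] [MulAction G (List X)]
    [SelfSim.SelfSimilarAction G X] (hc : SelfSim.IsContracting G X) :
    (∃ L : SelfSim.SelfSimilarStructure X (SelfSim.LimitSpace G X),
        L.π = SelfSim.LimitSpace.proj G X ∧ L.IsPCF) ↔
      SelfSim.LabelFixingCondition G X ∧ SelfSim.IsPCFAction G X := by
  constructor
  · rintro ⟨L, hL, hpcf⟩
    refine ⟨(SelfSim.labelFixingCondition_iff hc).2 fun x y i h => ?_,
      (SelfSim.isPCF_iff hc hL).1 hpcf⟩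
    rw [← SelfSim.LimitSpace.proj_eq_iff, ← hL] at h ⊢
    rw [← L.F_π, ← L.F_π, h]
  · rintro ⟨H, hpcf⟩
    exact ⟨SelfSim.limitStructure hc H, rfl, (SelfSim.isPCF_iff hc rfl).2 hpcf⟩
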